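/- Let $\mathcal{D}$ be a probability distribution on $\mathcal{X}\times\mathcal{Y}$ (measurable spaces), let $\Theta$ be a measurable space of parameters, and let $s(x,y;\theta)\in\mathbb{R}$ be a nonconformity function, jointly measurable in $(\theta,x,y)$. Let $N\ge 2$, $0<\hat\alpha\le\alpha<1$, $\delta\in(0,1)$, and assume $N\ge \frac{1}{\hat\alpha}-1$. Put $C(x;\tau,\theta)=\{y\in\mathcal{Y} : s(x,y;\theta)\le\tau\}$. For a data set $D=((x_1,y_1),\dots,(x_N,y_N))$ let $\tau^*(D,\hat\alpha;\theta)$ be the $\lceil (N+1)(1-\hat\alpha)\rceil/N$ quantile of the scores $s(x_1,y_1;\theta),\dots,s(x_N,y_N;\theta)$ counted with multiplicity, i.e. the $\lceil (N+1)(1-\hat\alpha)\rceil$-th smallest of them, and for a probability distribution $Q$ on $\Theta$ let $$\mathcal{L}_{\mathrm{cov}}(Q)=\mathbb{E}_{\theta\sim Q}\Big[\mathbb{P}_{(x,y)\sim\mathcal{D}}\big[\,y\notin C(x;\tau^*(D,\hat\alpha;\theta),\theta)\,\big]\Big].$$ Let $k=\lfloor (N+1)\hat\alpha\rfloor$, let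 $$B(N)=\mathrm{Beta}\Big(\tfrac{k-1}{N-1};\,k,\,N+1-k\Big)=\frac{N!}{(k-1)!\,(N-k)!}\Big(\frac{k-1}{N-1}\Big)^{k-1}\Big(\frac{N-k}{N-1}\Big)^{N-k}$$ (with $0^0=1$) be the value at $\frac{k-1}{N-1}$ of the density of the Beta distribution with parameters $k$ and $N+1-k$, let $\mathrm{kl}(p\Vert q)=p\log\frac pq+(1-p)\log\frac{1-p}{1-q}$ (with $0\log 0=0$) be the KL divergence between Bernoulli distributions with success probabilities $p$ and $q$, and let $\mathrm{KL}$ denote the KL divergence between probability measures, with values in $[0,\infty]$. Fix a (data-independent) prior probability distribution $P$ on $\Theta$. Then with probability greater than $1-\delta$ over the draw of a calibration data set $D$ of $N$ i.i.d. samples from $\mathcal{D}$, the following holds simultaneously for all probability distributions $Q$ on $\Theta$, including those that depend on $D$: if $$\mathrm{KL}(Q\Vert P)\le (N-1)\,\mathrm{kl}\Big(\tfrac{\lfloor (N+1)\hat\alpha\rfloor-1}{N-1}\,\Big\Vert\,\alpha\Big)-\log\frac{B(N)}{\delta},$$ then $\mathcal{L}_{\mathrm{cov}}(Q)\le\alpha$.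 -/

import Mathlib

open MeasureTheory

noncomputable section

/-- The prediction set `C(x; τ, θ) = {y | s(x, y; θ) ≤ τ}`: the `τ`-sublevel set of the
nonconformity function `s` with parameter `θ`, at the input `x`. -/
def predictionSet {Θ 𝒳 𝒴 : Type*} (s : Θ → 𝒳 → 𝒴 → ℝ) (θ : Θ) (τ : ℝ) (x : 𝒳) : Set 𝒴 :=
  {y | s θ x y ≤ τ}

/-- The `q`-quantile of the `N` numbers `v 0, …, v (N - 1)`, counted with multiplicity: the least
`t` such that at least a fraction `q` of them is `≤ t`. (For `0 < q ≤ 1` the set below is nonempty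
and bounded below, and its infimum is attained.) -/
def empiricalQuantile {N : ℕ} (q : ℝ) (v : Fin N → ℝ) : ℝ :=
  sInf {t : ℝ | q ≤ (Nat.card {i : Fin N // v i ≤ t} : ℝ) / N}

/-- The calibrated threshold `τ*(D, a; θ)`: the `⌈(N + 1)(1 - a)⌉ / N` quantile of the scores of
the calibration points `D = ((x₁, y₁), …, (x_N, y_N))`. -/
def conformalThreshold {Θ 𝒳 𝒴 : Type*} {N : ℕ} (s : Θ → 𝒳 → 𝒴 → ℝ) (D : Fin N → 𝒳 × 𝒴)
    (a : ℝ) (θ : Θ) : ℝ :=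
  empiricalQuantile ((⌈((N : ℝ) + 1) * (1 - a)⌉ : ℝ) / N) (fun i => s θ (D i).1 (D i).2)

/-- The test miscoverage, under `(x, y) ∼ 𝒟`, of the prediction set calibrated on `D` for the
parameter `θ`. -/
def miscoverage {Θ 𝒳 𝒴 : Type*} [MeasurableSpace 𝒳] [MeasurableSpace 𝒴] {N : ℕ}
    (𝒟 : Measure (𝒳 × 𝒴)) (s : Θ → 𝒳 → 𝒴 → ℝ) (D : Fin N → 𝒳 × 𝒴) (a : ℝ) (θ : Θ) : ENNReal :=
  𝒟 {z | z.2 ∉ predictionSet s θ (conformalThreshold s D a θ) z.1}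

/-- The randomized test miscoverage `L_cov(Q)`: the test miscoverage averaged over `θ ∼ Q`. -/
def randomizedMiscoverage {Θ 𝒳 𝒴 : Type*} [MeasurableSpace Θ] [MeasurableSpace 𝒳]
    [MeasurableSpace 𝒴] {N : ℕ} (𝒟 : Measure (𝒳 × 𝒴)) (s : Θ → 𝒳 → 𝒴 → ℝ) (D : Fin N → 𝒳 × 𝒴)
    (a : ℝ) (Q : Measure Θ) : ENNReal :=
  ∫⁻ θ, miscoverage 𝒟 s D a θ ∂Q

/-- The Kullback–Leibler divergence `kl(p ‖ q)` between the Bernoulli distributions with success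
probabilities `p ∈ [0, 1]` and `q ∈ (0, 1)` (with `0 log 0 = 0`). -/
def bernoulliKL (p q : ℝ) : ℝ :=
  p * Real.log (p / q) + (1 - p) * Real.log ((1 - p) / (1 - q))

/-- The density at `x ∈ [0, 1]` of the Beta distribution with positive integer parameters `a`, `b`,
by its formula on the closed interval. (Mathlib's `ProbabilityTheory.betaPDFReal` is `0` at the
endpoints, where the arguments needed here can lie, so it is not the right function there.) -/
def betaDensity (x : ℝ) (a b : ℕ) : ℝ :=
  ((a + b - 1).factorial : ℝ) / ((a - 1).factorial * (b - 1).factorial) *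
    x ^ (a - 1) * (1 - x) ^ (b - 1)

/-- The integer `k = ⌊(N + 1) a⌋`. -/
def calibrationIndex (N : ℕ) (a : ℝ) : ℕ := ⌊((N : ℝ) + 1) * a⌋₊

/-- The ratio `(⌊(N + 1) a⌋ - 1) / (N - 1)`. -/
def calibrationRatio (N : ℕ) (a : ℝ) : ℝ := ((calibrationIndex N a : ℝ) - 1) / ((N : ℝ) - 1)

/-- The constant `B(N) = Beta((k - 1) / (N - 1); k, N + 1 - k)`, where `k = ⌊(N + 1) a⌋`. -/
def pacBayesConstant (N : ℕ) (a : ℝ) : ℝ :=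
  betaDensity (calibrationRatio N a) (calibrationIndex N a) (N + 1 - calibrationIndex N a)

/-- The budget `(N - 1) kl((⌊(N + 1) a⌋ - 1) / (N - 1) ‖ α) - log (B(N) / δ)`. It may be
negative. -/
def klBudget (α a δ : ℝ) (N : ℕ) : ℝ :=
  ((N : ℝ) - 1) * bernoulliKL (calibrationRatio N a) α - Real.log (pacBayesConstant N a / δ)

end

/-! Write `k = κ + 1`, `N = κ + l + 1`, `n = κ + l`. For fixed `θ` the miscoverage `p` is
stochastically dominated by Beta(`κ + 1`, `l + 1`), even when the scores have atoms
(`measure_lt_survival_empiricalQuantile_le`). The Beta density `f(t) = (n + 1) C(n, κ) t^κ (1 -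
t)^l` is log-concave, so with `c = -(log f)'(α)` one has `f(u) exp(c (u - α)) ≤ f(α)` on `[0, 1]`.
For `c ≥ 0` this yields `E exp(c (p - α)) ≤ f(α)` (`lintegral_exp_le_of_measure_lt_le`).

Averaging over `θ ∼ P`, Markov's inequality and the Donsker–Varadhan inequality give, with
probability above `1 - δ` and for all `Q` at once, `c (L_cov(Q) - α) ≤ KL(Q ‖ P) + log (f(α) / δ)`.
The budget is exactly `log (δ / f(α))` (`klBudget_eq_log`), so the right side is nonpositive, and `c
> 0` concludes.

If `c ≤ 0`, then `κ` is a mode of the binomial law with parameters `n`, `α`. Its mass is at least `1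
/ (n + 1)`, so `f(α) ≥ 1`, the budget is negative and the claim is vacuous. -/

/-! ### Quantiles, survival functions and binomial counts -/

/-- The set defining the quantile is a finite union of closed half-lines, so its infimum is
attained. -/
theorem empiricalQuantile_le_iff {N m : ℕ} (hm : 0 < m) (hmN : m ≤ N) (v : Fin N → ℝ) (c : ℝ) :
    empiricalQuantile ((m : ℝ) / N) v ≤ c ↔ m ≤ Nat.card {i : Fin N // v i ≤ c} := by
  classical
  have hN : (0 : ℝ) < N := by exact_mod_cast hm.trans_le hmN
  have hcard : ∀ t, Nat.card {i : Fin N // v i ≤ t} = (Finset.univ.filter (v · ≤ t)).card := by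
    intro t
    rw [Nat.card_eq_fintype_card, Fintype.card_subtype]
  have hS : {t : ℝ | (m : ℝ) / N ≤ (Nat.card {i : Fin N // v i ≤ t} : ℝ) / N} =
      ⋃ I ∈ {I : Finset (Fin N) | m ≤ I.card}, ⋂ i ∈ I, Set.Ici (v i) := by
    ext t
    simp only [Set.mem_ofPred_eq, Set.mem_iUnion, Set.mem_iInter, Set.mem_Ici, exists_prop,
      div_le_div_iff_of_pos_right hN, Nat.cast_le, hcard]
    constructor
    · exact fun h => ⟨_, h, fun i hi => (Finset.mem_filter.1 hi).2⟩
    · rintro ⟨I, hI, h⟩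
      exact hI.trans (Finset.card_le_card fun i hi => by simpa using h i hi)
  have hmem : ∀ t, t ∈ {t : ℝ | (m : ℝ) / N ≤ (Nat.card {i : Fin N // v i ≤ t} : ℝ) / N} ↔
      m ≤ Nat.card {i : Fin N // v i ≤ t} := by
    intro t
    simp only [Set.mem_ofPred_eq, div_le_div_iff_of_pos_right hN, Nat.cast_le]
  have hclosed : IsClosed {t : ℝ | (m : ℝ) / N ≤ (Nat.card {i : Fin N // v i ≤ t} : ℝ) / N} := by
    rw [hS]
    exact (Set.toFinite _).isClosed_biUnion fun I _ =>
      isClosed_biInter fun i _ => isClosed_Ici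
  have hne : {t : ℝ | (m : ℝ) / N ≤ (Nat.card {i : Fin N // v i ≤ t} : ℝ) / N}.Nonempty := by
    obtain ⟨M, hM⟩ := (Set.finite_range v).bddAbove
    refine ⟨M, (hmem M).2 ?_⟩
    rw [hcard, Finset.filter_true_of_mem fun i _ => hM ⟨i, rfl⟩]
    simpa using hmN
  have hbdd : BddBelow {t : ℝ | (m : ℝ) / N ≤ (Nat.card {i : Fin N // v i ≤ t} : ℝ) / N} := by
    obtain ⟨b, hb⟩ := (Set.finite_range v).bddBelow
    refine ⟨b, fun t ht => ?_⟩
    have h := hm.trans_le ((hmem t).1 ht)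
    rw [hcard, Finset.card_pos] at h
    obtain ⟨i, hi⟩ := h
    exact (hb ⟨i, rfl⟩).trans (Finset.mem_filter.1 hi).2
  constructor
  · intro h
    refine ((hmem _).1 (hclosed.csInf_mem hne hbdd)).trans ?_
    rw [hcard, hcard]
    exact Finset.card_le_card fun i hi => by
      simp only [Finset.mem_filter, Finset.mem_univ, true_and] at hi ⊢
      exact hi.trans h
  · exact fun h => csInf_le hbdd ((hmem c).2 h)

/-- The set is a lower set whose supremum may not belong to it. A compact subset of nearly full
measure has a greatest element `x`, lies in `Iic x`, and `x` itself satisfies the strict bound. -/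
theorem measure_lt_survival_le (μ : Measure ℝ) [IsProbabilityMeasure μ] (t : ENNReal) :
    μ {x | t < μ (Set.Ioi x)} ≤ 1 - t := by
  have hanti : Antitone fun x => μ (Set.Ioi x) :=
    fun x y h => measure_mono (Set.Ioi_subset_Ioi h)
  have hA : MeasurableSet {x | t < μ (Set.Ioi x)} :=
    measurableSet_lt measurable_const hanti.measurable
  refine le_of_forall_lt fun r hr => ?_
  obtain ⟨K, hKA, hK, hrK⟩ := hA.exists_lt_isCompact hr
  have hne : K.Nonempty := by
    rw [Set.nonempty_iff_ne_empty]
    rintro rfl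
    simp at hrK
  obtain ⟨x, hxK, hx⟩ := hK.exists_isGreatest hne
  have hle : μ K ≤ 1 - μ (Set.Ioi x) := by
    rw [← prob_compl_eq_one_sub measurableSet_Ioi, Set.compl_Ioi]
    exact measure_mono fun y hy => hx hy
  exact (hrK.trans_le hle).trans_le (tsub_le_tsub_left (hKA hxK).le 1)

/-- A union bound over the index sets of the points falling in `A`. -/
theorem measure_pi_card_lt_le {Ω : Type*} [MeasurableSpace Ω] (μ : Measure Ω)
    [IsProbabilityMeasure μ] {A : Set Ω} (hA : MeasurableSet A) (N k : ℕ) :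
    Measure.pi (fun _ : Fin N => μ) {D | Nat.card {i : Fin N // D i ∈ A} < k} ≤
      ENNReal.ofReal
        (∑ j ∈ Finset.range k, (bernsteinPolynomial ℝ N j).eval (μ.real A)) := by
  classical
  have hsub : {D : Fin N → Ω | Nat.card {i : Fin N // D i ∈ A} < k} ⊆
      ⋃ j ∈ Finset.range k, ⋃ I ∈ Finset.powersetCard j (Finset.univ : Finset (Fin N)),
        Set.univ.pi fun i => if i ∈ I then A else Aᶜ := by
    intro D hD
    simp only [Set.mem_iUnion, exists_prop]
    refine ⟨_, Finset.mem_range.2 hD, Finset.univ.filter (D · ∈ A), ?_, ?_⟩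
    · rw [Finset.mem_powersetCard, Nat.card_eq_fintype_card, Fintype.card_subtype]
      exact ⟨Finset.subset_univ _, rfl⟩
    · intro i _
      by_cases h : D i ∈ A <;> simp [h]
  have h0 : 0 ≤ μ.real A := measureReal_nonneg
  have h1 : 0 ≤ 1 - μ.real A := sub_nonneg.2 measureReal_le_one
  refine (measure_mono hsub).trans ((measure_biUnion_finset_le _ _).trans ?_)
  rw [ENNReal.ofReal_sum_of_nonneg fun j _ => by
    simp only [bernsteinPolynomial, Polynomial.eval_mul, Polynomial.eval_natCast,
      Polynomial.eval_pow, Polynomial.eval_X, Polynomial.eval_sub, Polynomial.eval_one]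
    positivity]
  refine Finset.sum_le_sum fun j _ => (measure_biUnion_finset_le _ _).trans ?_
  have hI : ∀ I ∈ Finset.powersetCard j (Finset.univ : Finset (Fin N)),
      Measure.pi (fun _ : Fin N => μ) (Set.univ.pi fun i => if i ∈ I then A else Aᶜ) =
        ENNReal.ofReal (μ.real A ^ j * (1 - μ.real A) ^ (N - j)) := by
    intro I hI
    have hc : μ Aᶜ = ENNReal.ofReal (1 - μ.real A) := by
      rw [← probReal_compl_eq_one_sub hA, ofReal_measureReal]
    have hIc := (Finset.mem_powersetCard.1 hI).2
    rw [Measure.pi_pi]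
    simp only [apply_ite μ]
    rw [Finset.prod_ite, Finset.prod_const, Finset.prod_const, Finset.filter_mem_eq_inter,
      Finset.univ_inter, Finset.filter_not, Finset.filter_mem_eq_inter, Finset.univ_inter,
      ← Finset.compl_eq_univ_sdiff, Finset.card_compl, hIc, Fintype.card_fin, hc,
      ENNReal.ofReal_mul (by positivity), ENNReal.ofReal_pow h0, ENNReal.ofReal_pow h1,
      ofReal_measureReal]
  rw [Finset.sum_congr rfl hI, Finset.sum_const, Finset.card_powersetCard, Finset.card_univ,
    Fintype.card_fin, nsmul_eq_mul, ← ENNReal.ofReal_natCast, ← ENNReal.ofReal_mul (by positivity)]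
  simp [bernsteinPolynomial, mul_assoc]

/-! ### Binomial masses as Bernstein polynomials -/

/-- The sum telescopes. This identifies the binomial lower tail, as a function of the success
probability, with a Beta survival function. -/
theorem derivative_sum_bernsteinPolynomial (n κ : ℕ) :
    Polynomial.derivative (∑ j ∈ Finset.range (κ + 1), bernsteinPolynomial ℝ (n + 1) j) =
      -((n : Polynomial ℝ) + 1) * bernsteinPolynomial ℝ n κ := by
  induction κ with
  | zero => simp [bernsteinPolynomial.derivative_zero]
  | succ κ ih =>
    rw [Finset.sum_range_succ, Polynomial.derivative_add, ih, bernsteinPolynomial.derivative_succ]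
    push_cast
    ring

theorem eval_bernsteinPolynomial (n j : ℕ) (t : ℝ) :
    (bernsteinPolynomial ℝ n j).eval t = n.choose j * t ^ j * (1 - t) ^ (n - j) := by
  simp [bernsteinPolynomial]

theorem eval_bernsteinPolynomial_nonneg (n j : ℕ) {t : ℝ} (h0 : 0 ≤ t) (h1 : t ≤ 1) :
    0 ≤ (bernsteinPolynomial ℝ n j).eval t := by
  have : 0 ≤ 1 - t := sub_nonneg.2 h1
  rw [eval_bernsteinPolynomial]
  positivity

theorem antitoneOn_sum_eval_bernsteinPolynomial (n κ : ℕ) :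
    AntitoneOn (fun t : ℝ => ∑ j ∈ Finset.range (κ + 1), (bernsteinPolynomial ℝ (n + 1) j).eval t)
      (Set.Icc 0 1) := by
  simp only [← Polynomial.eval_finsetSum]
  refine antitoneOn_of_deriv_nonpos (convex_Icc 0 1) (Polynomial.continuousOn _)
    (Polynomial.differentiable _).differentiableOn fun t ht => ?_
  rw [interior_Icc] at ht
  rw [Polynomial.deriv, derivative_sum_bernsteinPolynomial]
  have := eval_bernsteinPolynomial_nonneg n κ ht.1.le ht.2.le
  simp only [Polynomial.eval_mul, Polynomial.eval_neg, Polynomial.eval_add,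
    Polynomial.eval_natCast, Polynomial.eval_one]
  have : 0 ≤ ((n : ℝ) + 1) * (bernsteinPolynomial ℝ n κ).eval t := by positivity
  linarith

/-- Consecutive values of the binomial mass function. -/
theorem eval_bernsteinPolynomial_succ_mul (n j : ℕ) (hj : j < n) (t : ℝ) :
    (bernsteinPolynomial ℝ n (j + 1)).eval t * ((j + 1) * (1 - t)) =
      (bernsteinPolynomial ℝ n j).eval t * ((n - j) * t) := by
  obtain ⟨l, rfl⟩ : ∃ l, n = j + l + 1 := ⟨n - j - 1, by omega⟩
  have h := congrArg (Nat.cast (R := ℝ)) (Nat.choose_succ_right_eq (j + l + 1) j)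
  rw [show j + l + 1 - j = l + 1 by omega] at h
  push_cast at h
  rw [eval_bernsteinPolynomial, eval_bernsteinPolynomial, show j + l + 1 - (j + 1) = l by omega,
    show j + l + 1 - j = l + 1 by omega]
  push_cast
  linear_combination (t ^ (j + 1) * (1 - t) ^ (l + 1)) * h

/-- `κ` is a mode of the binomial distribution with parameters `n`, `t` if
`κ ≤ (n + 1) t ≤ κ + 1`. -/
theorem eval_bernsteinPolynomial_le_mode {n κ : ℕ} {t : ℝ} (h0 : 0 < t) (h1 : t < 1)
    (hκn : κ ≤ n) (hl : (κ : ℝ) ≤ (n + 1) * t) (hu : (n + 1) * t ≤ κ + 1) (j : ℕ) (hj : j ≤ n) :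
    (bernsteinPolynomial ℝ n j).eval t ≤ (bernsteinPolynomial ℝ n κ).eval t := by
  have ht : 0 < 1 - t := sub_pos.2 h1
  rcases le_total κ j with h | h
  · induction j, h using Nat.le_induction with
    | base => exact le_rfl
    | succ j hκj ih =>
      refine le_trans ?_ (ih (by omega))
      have hpos : (0 : ℝ) < (j + 1) * (1 - t) := by positivity
      have hκj' : (κ : ℝ) ≤ j := by exact_mod_cast hκj
      refine le_of_mul_le_mul_right ?_ hpos
      rw [eval_bernsteinPolynomial_succ_mul n j (by omega)]
      exact mul_le_mul_of_nonneg_left (by linarith)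
        (eval_bernsteinPolynomial_nonneg n j h0.le h1.le)
  · induction h using Nat.decreasingInduction with
    | self => exact le_rfl
    | of_succ j hjκ ih =>
      refine le_trans ?_ (ih (by omega))
      have hpos : (0 : ℝ) < (j + 1) * (1 - t) := by positivity
      have hκj' : (j : ℝ) + 1 ≤ κ := by exact_mod_cast hjκ
      refine le_of_mul_le_mul_right ?_ hpos
      rw [eval_bernsteinPolynomial_succ_mul n j (by omega)]
      exact mul_le_mul_of_nonneg_left (by linarith)
        (eval_bernsteinPolynomial_nonneg n j h0.le h1.le)

/-- The `n + 1` masses sum to one and the mode carries the largest. -/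
theorem one_le_mul_eval_bernsteinPolynomial {n κ : ℕ} {t : ℝ} (h0 : 0 < t) (h1 : t < 1)
    (hκn : κ ≤ n) (hl : (κ : ℝ) ≤ (n + 1) * t) (hu : (n + 1) * t ≤ κ + 1) :
    1 ≤ ((n : ℝ) + 1) * (bernsteinPolynomial ℝ n κ).eval t := by
  have hsum : ∑ j ∈ Finset.range (n + 1), (bernsteinPolynomial ℝ n j).eval t = 1 := by
    rw [← Polynomial.eval_finsetSum, bernsteinPolynomial.sum, Polynomial.eval_one]
  calc (1 : ℝ) = ∑ j ∈ Finset.range (n + 1), (bernsteinPolynomial ℝ n j).eval t := hsum.symm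
    _ ≤ ∑ _j ∈ Finset.range (n + 1), (bernsteinPolynomial ℝ n κ).eval t :=
      Finset.sum_le_sum fun j hj => eval_bernsteinPolynomial_le_mode h0 h1 hκn hl hu j
        (Nat.lt_succ_iff.1 (Finset.mem_range.1 hj))
    _ = _ := by simp

/-- Log-concavity of `t ↦ t ^ κ * (1 - t) ^ l`, as a tangent inequality at `α`. -/
theorem eval_bernsteinPolynomial_mul_exp_le {κ l : ℕ} {α u : ℝ} (h0 : 0 < α) (h1 : α < 1)
    (hu0 : 0 ≤ u) (hu1 : u ≤ 1) :
    (bernsteinPolynomial ℝ (κ + l) κ).eval u * Real.exp ((l / (1 - α) - κ / α) * (u - α)) ≤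
      (bernsteinPolynomial ℝ (κ + l) κ).eval α := by
  have hα : 0 < 1 - α := sub_pos.2 h1
  have hu : 0 ≤ 1 - u := sub_nonneg.2 hu1
  -- Both factors are bounded by `1 + x ≤ exp x`, with equality at `u = α`; the resulting exponents
  -- cancel the tilt exactly.
  have e1 : u ≤ α * Real.exp ((u - α) / α) := by
    have := Real.add_one_le_exp ((u - α) / α)
    rwa [sub_div, div_self h0.ne', sub_add_cancel, div_le_iff₀' h0, ← div_self h0.ne', ← sub_div]
      at this
  have e2 : 1 - u ≤ (1 - α) * Real.exp (-(u - α) / (1 - α)) := by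
    have := Real.add_one_le_exp (-(u - α) / (1 - α))
    have h2 : -(u - α) / (1 - α) + 1 = (1 - u) / (1 - α) := by field_simp; ring
    rwa [h2, div_le_iff₀' hα] at this
  have p1 := pow_le_pow_left₀ hu0 e1 κ
  have p2 := pow_le_pow_left₀ hu e2 l
  rw [mul_pow, ← Real.exp_nat_mul] at p1 p2
  have hexp : Real.exp ((κ : ℝ) * ((u - α) / α)) * Real.exp ((l : ℝ) * (-(u - α) / (1 - α))) *
      Real.exp ((l / (1 - α) - κ / α) * (u - α)) = 1 := by
    rw [← Real.exp_add, ← Real.exp_add, Real.exp_eq_one_iff]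
    ring
  rw [eval_bernsteinPolynomial, eval_bernsteinPolynomial, Nat.add_sub_cancel_left]
  calc _ = ((κ + l).choose κ : ℝ) * Real.exp ((l / (1 - α) - κ / α) * (u - α)) *
        (u ^ κ * (1 - u) ^ l) := by ring
    _ ≤ ((κ + l).choose κ : ℝ) * Real.exp ((l / (1 - α) - κ / α) * (u - α)) *
        ((α ^ κ * Real.exp ((κ : ℝ) * ((u - α) / α))) *
          ((1 - α) ^ l * Real.exp ((l : ℝ) * (-(u - α) / (1 - α))))) := by
      gcongr
    _ = ((κ + l).choose κ : ℝ) * α ^ κ * (1 - α) ^ l *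
        (Real.exp ((κ : ℝ) * ((u - α) / α)) * Real.exp ((l : ℝ) * (-(u - α) / (1 - α))) *
          Real.exp ((l / (1 - α) - κ / α) * (u - α))) := by ring
    _ = _ := by rw [hexp, mul_one]

/-! ### Two general inequalities: Donsker–Varadhan and Markov -/

/-- The Donsker–Varadhan inequality. -/
theorem integral_le_toReal_klDiv_add_log {Θ : Type*} [MeasurableSpace Θ] {Q P : Measure Θ}
    [IsProbabilityMeasure Q] [IsProbabilityMeasure P] (hKL : InformationTheory.klDiv Q P ≠ ⊤)
    {f : Θ → ℝ} (hfQ : Integrable f Q) (hfP : Integrable (fun x => Real.exp (f x)) P) :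
    ∫ x, f x ∂Q ≤ (InformationTheory.klDiv Q P).toReal + Real.log (∫ x, Real.exp (f x) ∂P) := by
  obtain ⟨hac, hint⟩ := InformationTheory.klDiv_ne_top_iff.1 hKL
  have : IsProbabilityMeasure (P.tilted f) := isProbabilityMeasure_tilted hfP
  have h := InformationTheory.integral_llr_add_sub_measure_univ_nonneg
    (hac.trans (absolutelyContinuous_tilted hfP)) (integrable_llr_tilted_right hac hfQ hint hfP)
  rw [integral_llr_tilted_right hac hfQ hfP hint] at h
  rw [InformationTheory.toReal_klDiv_of_measure_eq hac (by simp)]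
  simp only [probReal_univ] at h
  linarith

/-- Markov's inequality with a strict conclusion. -/
theorem measure_lt_mul_lt {Ω : Type*} [MeasurableSpace Ω] {μ : Measure Ω}
    [IsFiniteMeasure μ] {X : Ω → ENNReal}
    (hX : Measurable X) {b δ : ℝ} (hb : 0 < b) (hδ : 0 < δ)
    (hE : ∫⁻ ω, X ω ∂μ ≤ ENNReal.ofReal b) :
    μ {ω | ENNReal.ofReal (b / δ) < X ω} < ENNReal.ofReal δ := by
  -- Strictness of the integral comparison needs an exceedance set of positive measure.
  by_cases h0 : μ {ω | ENNReal.ofReal (b / δ) < X ω} = 0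
  · rw [h0]
    exact ENNReal.ofReal_pos.2 hδ
  have hs : MeasurableSet {ω | ENNReal.ofReal (b / δ) < X ω} := measurableSet_lt measurable_const hX
  have hlt := setLIntegral_strict_mono hs h0 hX (f := fun _ => ENNReal.ofReal (b / δ))
    (by simpa using ENNReal.mul_ne_top ENNReal.ofReal_ne_top (measure_ne_top _ _))
    (ae_of_all _ fun ω hω => hω)
  rw [setLIntegral_const] at hlt
  have h2 := hlt.trans_le ((setLIntegral_le_lintegral _ _).trans hE)
  have h3 : ENNReal.ofReal b = ENNReal.ofReal (b / δ) * ENNReal.ofReal δ := by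
    rw [← ENNReal.ofReal_mul (by positivity), div_mul_cancel₀ _ hδ.ne']
  rw [h3] at h2
  exact lt_of_mul_lt_mul_left' h2

/-! ### Beta domination and the exponential moment -/

theorem measure_lt_survival_empiricalQuantile_le {Z : Type*} [MeasurableSpace Z] (μ : Measure Z)
    [IsProbabilityMeasure μ] {σ : Z → ℝ} (hσ : Measurable σ) {n κ : ℕ} (hκ : κ ≤ n) {t : ℝ}
    (h0 : 0 ≤ t) (h1 : t ≤ 1) :
    Measure.pi (fun _ : Fin (n + 1) => μ) {D | ENNReal.ofReal t <
        μ {z | empiricalQuantile (((n + 1 - κ : ℕ) : ℝ) / (n + 1 : ℕ)) (fun i => σ (D i)) < σ z}} ≤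
      ENNReal.ofReal
        (∑ j ∈ Finset.range (κ + 1), (bernsteinPolynomial ℝ (n + 1) j).eval t) := by
  classical
  have hμσ : IsProbabilityMeasure (μ.map σ) := Measure.isProbabilityMeasure_map hσ.aemeasurable
  have hmap : ∀ x, μ.map σ (Set.Ioi x) = μ {z | x < σ z} := fun x =>
    Measure.map_apply hσ measurableSet_Ioi
  have hanti : Antitone fun x => μ.map σ (Set.Ioi x) :=
    fun x y h => measure_mono (Set.Ioi_subset_Ioi h)
  -- `A` does not depend on the sample. When the miscoverage exceeds `t`, every calibration point
  -- with score at most `τ` lies in `A`, which leaves at most `κ` points in `Aᶜ`, a set of mass at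
  -- least `t`.
  set A : Set Z := σ ⁻¹' {x | ENNReal.ofReal t < μ.map σ (Set.Ioi x)} with hA
  have hmA0 : MeasurableSet {x | ENNReal.ofReal t < μ.map σ (Set.Ioi x)} :=
    measurableSet_lt measurable_const hanti.measurable
  have hmA : MeasurableSet A := hσ hmA0
  have hμA : μ A ≤ 1 - ENNReal.ofReal t := by
    rw [hA, ← Measure.map_apply hσ hmA0]
    exact measure_lt_survival_le _ _
  have hreal : t ≤ μ.real Aᶜ := by
    rw [probReal_compl_eq_one_sub hmA]
    have := ENNReal.toReal_mono (by simp) hμA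
    rw [ENNReal.toReal_sub_of_le (by simpa using h1) (by simp), ENNReal.toReal_one,
      ENNReal.toReal_ofReal h0] at this
    rw [measureReal_def]
    linarith
  refine (measure_mono ?_).trans ((measure_pi_card_lt_le μ hmA.compl (n + 1) (κ + 1)).trans
    (ENNReal.ofReal_le_ofReal (antitoneOn_sum_eval_bernsteinPolynomial n κ ⟨h0, h1⟩
      ⟨measureReal_nonneg, measureReal_le_one⟩ hreal)))
  intro D hD
  simp only [Set.mem_ofPred_eq] at hD ⊢
  set τ := empiricalQuantile (((n + 1 - κ : ℕ) : ℝ) / (n + 1 : ℕ)) (fun i => σ (D i)) with hτ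
  have hcard := (empiricalQuantile_le_iff (by omega) (by omega) (fun i => σ (D i)) τ).1 hτ.ge
  have hle : Nat.card {i : Fin (n + 1) // σ (D i) ≤ τ} ≤ Nat.card {i : Fin (n + 1) // D i ∈ A} := by
    refine Nat.card_le_card_of_injective
      (Subtype.map id fun i hi => ?_) (Subtype.map_injective _ Function.injective_id)
    refine lt_of_lt_of_le hD ?_
    rw [← hmap]
    exact hanti hi
  have hadd : Nat.card {i : Fin (n + 1) // D i ∈ A} + Nat.card {i : Fin (n + 1) // D i ∈ Aᶜ} =
      n + 1 := by
    rw [Nat.card_eq_fintype_card, Nat.card_eq_fintype_card, Fintype.card_subtype,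
      Fintype.card_subtype]
    simpa using Finset.card_filter_add_card_filter_not (s := (Finset.univ : Finset (Fin (n + 1))))
      (fun i => D i ∈ A)
  omega

/-- If `p` is stochastically dominated by the `Beta (κ + 1, l + 1)` distribution, then the
exponential moment of `p` with the slope of the log-density at `α` is at most the density at `α`. -/
theorem lintegral_exp_le_of_measure_lt_le {Ω : Type*} [MeasurableSpace Ω] (μ : Measure Ω)
    [IsProbabilityMeasure μ] {p : Ω → ℝ} (hp : Measurable p) (hp0 : ∀ ω, 0 ≤ p ω)
    (hp1 : ∀ ω, p ω ≤ 1) {κ l : ℕ}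
    (htail : ∀ t, 0 ≤ t → t ≤ 1 → μ {ω | t < p ω} ≤ ENNReal.ofReal
      (∑ j ∈ Finset.range (κ + 1), (bernsteinPolynomial ℝ (κ + l + 1) j).eval t))
    {α : ℝ} (h0 : 0 < α) (h1 : α < 1) {c : ℝ} (hc : c = l / (1 - α) - κ / α) (hc0 : 0 ≤ c) :
    ∫⁻ ω, ENNReal.ofReal (Real.exp (c * (p ω - α))) ∂μ ≤
      ENNReal.ofReal ((((κ + l : ℕ) : ℝ) + 1) * (bernsteinPolynomial ℝ (κ + l) κ).eval α) := by
  -- `T` is the survival function of Beta(`κ + 1`, `l + 1`) and `f` below is its density. The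
  -- layer-cake formula turns the tail bound into a bound by `∫ T g`, and integration by parts turns
  -- that into `∫ f G`.
  set T : Polynomial ℝ := ∑ j ∈ Finset.range (κ + 1), bernsteinPolynomial ℝ (κ + l + 1) j with hT
  set G : ℝ → ℝ := fun t => Real.exp (c * (t - α)) with hG
  set g : ℝ → ℝ := fun t => Real.exp (c * (t - α)) * c with hg
  set f : ℝ → ℝ := fun t => (((κ + l : ℕ) : ℝ) + 1) * (bernsteinPolynomial ℝ (κ + l) κ).eval t
    with hf
  have hGd : ∀ t, HasDerivAt G (g t) t := fun t => by
    have := (((hasDerivAt_id t).sub_const α).const_mul c).exp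
    rwa [mul_one] at this
  have hgc : Continuous g := by fun_prop
  have hGc : Continuous G := by fun_prop
  have hfc : Continuous f := continuous_const.mul (Polynomial.continuous _)
  have hg0 : ∀ t, 0 ≤ g t := fun t => by positivity
  have hTd : ∀ t, HasDerivAt (fun t => T.eval t) (-f t) t := fun t => by
    refine (T.hasDerivAt t).congr_deriv ?_
    rw [hT, derivative_sum_bernsteinPolynomial]
    simp only [Polynomial.eval_mul, Polynomial.eval_neg, Polynomial.eval_add,
      Polynomial.eval_natCast, Polynomial.eval_one, hf]
    push_cast
    ring
  have hTeval : ∀ t, T.eval t =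
      ∑ j ∈ Finset.range (κ + 1), (bernsteinPolynomial ℝ (κ + l + 1) j).eval t :=
    fun t => Polynomial.eval_finsetSum _ _ _
  have hT0 : T.eval 0 = 1 := by
    rw [hTeval]
    simp [bernsteinPolynomial.eval_at_0]
  have hT1 : T.eval 1 = 0 := by
    rw [hTeval]
    refine Finset.sum_eq_zero fun j hj => ?_
    rw [bernsteinPolynomial.eval_at_1, if_neg]
    have := Finset.mem_range.1 hj
    omega
  have hTnn : ∀ t, 0 ≤ t → t ≤ 1 → 0 ≤ T.eval t := fun t a b => by
    rw [hTeval]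
    exact Finset.sum_nonneg fun j _ => eval_bernsteinPolynomial_nonneg _ _ a b
  have hparts : ∫ t in (0 : ℝ)..1, T.eval t * g t = -G 0 + ∫ t in (0 : ℝ)..1, f t * G t := by
    rw [intervalIntegral.integral_mul_deriv_eq_deriv_mul (fun x _ => hTd x) (fun x _ => hGd x)
      (hfc.neg.intervalIntegrable _ _) (hgc.intervalIntegrable _ _), hT0, hT1]
    simp
  have hfG : ∫ t in (0 : ℝ)..1, f t * G t ≤ f α := by
    have := intervalIntegral.integral_mono_on (a := 0) (b := 1) zero_le_one
      ((hfc.mul hGc).intervalIntegrable _ _) (continuous_const.intervalIntegrable (μ := volume) _ _)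
      (g := fun _ => f α) fun u hu => by
        have := eval_bernsteinPolynomial_mul_exp_le (κ := κ) (l := l) h0 h1 hu.1 hu.2
        rw [← hc] at this
        simp only [hf, hG, Pi.mul_apply, mul_assoc]
        exact mul_le_mul_of_nonneg_left this (add_nonneg (Nat.cast_nonneg _) zero_le_one)
    simpa using this
  have hTg0 : 0 ≤ ∫ t in (0 : ℝ)..1, T.eval t * g t :=
    intervalIntegral.integral_nonneg zero_le_one fun t ht =>
      mul_nonneg (hTnn t ht.1 ht.2) (hg0 t)
  have hFTC : ∀ x, ∫ t in (0 : ℝ)..x, g t = G x - G 0 := fun x =>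
    intervalIntegral.integral_eq_sub_of_hasDerivAt (fun t _ => hGd t)
      (hgc.intervalIntegrable _ _)
  have hlayer : ∫⁻ ω, ENNReal.ofReal (G (p ω) - G 0) ∂μ ≤
      ENNReal.ofReal (∫ t in (0 : ℝ)..1, T.eval t * g t) := by
    simp_rw [← hFTC]
    rw [lintegral_comp_eq_lintegral_meas_lt_mul μ (ae_of_all _ hp0) hp.aemeasurable
      (fun t _ => hgc.intervalIntegrable _ _) (ae_of_all _ hg0)]
    have hTgc : Continuous fun t => T.eval t * g t := T.continuous.mul hgc
    rw [intervalIntegral.integral_of_le zero_le_one,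
      ofReal_integral_eq_lintegral_ofReal (hTgc.integrableOn_Ioc)
        ((ae_restrict_iff' measurableSet_Ioc).2 (ae_of_all _ fun t ht =>
          mul_nonneg (hTnn t ht.1.le ht.2) (hg0 t))),
      ← lintegral_indicator measurableSet_Ioi, ← lintegral_indicator measurableSet_Ioc]
    refine lintegral_mono fun t => ?_
    by_cases ht0 : 0 < t
    · by_cases ht1 : t ≤ 1
      · rw [Set.indicator_of_mem (Set.mem_Ioi.2 ht0), Set.indicator_of_mem (Set.mem_Ioc.2 ⟨ht0, ht1⟩),
          ENNReal.ofReal_mul (hTnn t ht0.le ht1), hTeval]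
        exact mul_le_mul_left (htail t ht0.le ht1) _
      · have : {ω | t < p ω} = ∅ := by
          ext ω
          simpa using (hp1 ω).trans (not_le.1 ht1).le
        rw [Set.indicator_of_mem (Set.mem_Ioi.2 ht0), this]
        simp
    · rw [Set.indicator_of_notMem (by simpa using ht0)]
      exact zero_le
  have hG0 : 0 ≤ G 0 := (Real.exp_pos _).le
  have hGp : ∀ ω, 0 ≤ G (p ω) - G 0 := fun ω => by
    rw [← hFTC]
    exact intervalIntegral.integral_nonneg (hp0 ω) fun t _ => hg0 t
  calc ∫⁻ ω, ENNReal.ofReal (G (p ω)) ∂μ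
      = ∫⁻ ω, (ENNReal.ofReal (G (p ω) - G 0) + ENNReal.ofReal (G 0)) ∂μ := by
        refine lintegral_congr fun ω => ?_
        rw [← ENNReal.ofReal_add (hGp ω) hG0, sub_add_cancel]
    _ = ∫⁻ ω, ENNReal.ofReal (G (p ω) - G 0) ∂μ + ENNReal.ofReal (G 0) := by
        rw [lintegral_add_right _ measurable_const, lintegral_const, measure_univ, mul_one]
    _ ≤ ENNReal.ofReal (∫ t in (0 : ℝ)..1, T.eval t * g t) + ENNReal.ofReal (G 0) := by gcongr
    _ = ENNReal.ofReal ((∫ t in (0 : ℝ)..1, T.eval t * g t) + G 0) :=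
        (ENNReal.ofReal_add hTg0 hG0).symm
    _ ≤ ENNReal.ofReal (f α) := ENNReal.ofReal_le_ofReal (by rw [hparts]; linarith)

/-! ### The budget in closed form -/

theorem betaDensity_eq_eval_bernsteinPolynomial (x : ℝ) (κ l : ℕ) :
    betaDensity x (κ + 1) (l + 1) =
      (((κ + l : ℕ) : ℝ) + 1) * (bernsteinPolynomial ℝ (κ + l) κ).eval x := by
  have h : (((κ + l).choose κ : ℕ) : ℝ) * κ.factorial * l.factorial = (κ + l).factorial := by
    have := Nat.choose_mul_factorial_mul_factorial (Nat.le_add_right κ l)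
    rw [Nat.add_sub_cancel_left] at this
    exact_mod_cast this
  rw [betaDensity, eval_bernsteinPolynomial, show κ + 1 + (l + 1) - 1 = κ + l + 1 by omega,
    Nat.factorial_succ, Nat.add_sub_cancel, Nat.add_sub_cancel, Nat.add_sub_cancel_left,
    Nat.cast_mul, ← h]
  have : (κ.factorial : ℝ) ≠ 0 := by positivity
  have : (l.factorial : ℝ) ≠ 0 := by positivity
  field_simp
  push_cast
  ring

/-- Multiplying the Beta density at `κ / (κ + l)` by `exp (-(κ + l) kl)` replaces that point by `α`,
since the powers of `κ / (κ + l)` and `l / (κ + l)` cancel. -/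
theorem klBudget_eq_log {α a δ : ℝ} {κ l : ℕ} (hα0 : 0 < α) (hα1 : α < 1) (hδ : 0 < δ)
    (hn : 0 < κ + l) (hk : calibrationIndex (κ + l + 1) a = κ + 1) :
    klBudget α a δ (κ + l + 1) =
      Real.log (δ / ((((κ + l : ℕ) : ℝ) + 1) * (bernsteinPolynomial ℝ (κ + l) κ).eval α)) := by
  have hα : 0 < 1 - α := sub_pos.2 hα1
  have hnR : (0 : ℝ) < (κ : ℝ) + l := by exact_mod_cast hn
  have hr : calibrationRatio (κ + l + 1) a = κ / (κ + l) := by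
    rw [calibrationRatio, hk]
    push_cast
    ring_nf
  have hr1 : 1 - (κ : ℝ) / (κ + l) = l / (κ + l) := by
    field_simp
    ring
  -- Valid also at `m = 0`, where `0 log 0 = 0` matches `0 ^ 0 = 1`.
  have hxlog : ∀ (m : ℕ) (b : ℝ), 0 < b → (m : ℝ) * Real.log (m / (κ + l) / b) =
      Real.log ((m / (κ + l) : ℝ) ^ m) - m * Real.log b := by
    intro m b hb
    rcases Nat.eq_zero_or_pos m with rfl | hm
    · simp
    · have hm' : (0 : ℝ) < m := by exact_mod_cast hm
      rw [Real.log_div (by positivity) hb.ne', Real.log_pow]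
      ring
  have hpow : ∀ m : ℕ, (m / (κ + l) : ℝ) ^ m ≠ 0 := by
    intro m
    rcases Nat.eq_zero_or_pos m with rfl | hm
    · simp
    · positivity
  have hc : (((κ + l).choose κ : ℕ) : ℝ) ≠ 0 := by
    exact_mod_cast (Nat.choose_pos (Nat.le_add_right κ l)).ne'
  have hn1 : (((κ + l : ℕ) : ℝ) + 1) ≠ 0 := by positivity
  have hkl : (((κ + l + 1 : ℕ) : ℝ) - 1) * bernoulliKL (κ / (κ + l)) α =
      (κ : ℝ) * Real.log (κ / (κ + l) / α) + l * Real.log (l / (κ + l) / (1 - α)) := by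
    rw [bernoulliKL, hr1]
    push_cast
    field_simp
    ring
  have hκ := hpow κ
  have hl := hpow l
  have hακ : α ^ κ ≠ 0 := by positivity
  have hαl : (1 - α) ^ l ≠ 0 := by positivity
  rw [klBudget, pacBayesConstant, hk, show κ + l + 1 + 1 - (κ + 1) = l + 1 by omega,
    betaDensity_eq_eval_bernsteinPolynomial, hr, hkl, hxlog _ _ hα0, hxlog _ _ hα,
    eval_bernsteinPolynomial, eval_bernsteinPolynomial, Nat.add_sub_cancel_left, hr1,
    Real.log_div (by positivity) hδ.ne', Real.log_div hδ.ne' (by positivity),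
    Real.log_mul hn1 (by positivity), Real.log_mul (by positivity) hl, Real.log_mul hc hκ,
    Real.log_mul hn1 (by positivity), Real.log_mul (by positivity) hαl, Real.log_mul hc hακ,
    Real.log_pow α, Real.log_pow (1 - α)]
  ring

/-! ### The calibrated threshold, measurability and the moment at a fixed parameter -/

theorem conformalThreshold_eq {Θ 𝒳 𝒴 : Type*} {N k : ℕ} (s : Θ → 𝒳 → 𝒴 → ℝ) (D : Fin N → 𝒳 × 𝒴)
    {a : ℝ} (ha : 0 ≤ a) (hk : calibrationIndex N a = k) (hkN : k ≤ N + 1) (θ : Θ) :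
    conformalThreshold s D a θ =
      empiricalQuantile (((N + 1 - k : ℕ) : ℝ) / N) (fun i => s θ (D i).1 (D i).2) := by
  have h : ⌈((N : ℝ) + 1) * (1 - a)⌉ = ((N + 1 - k : ℕ) : ℤ) := by
    have h1 : ((N : ℝ) + 1) * (1 - a) = ((N + 1 : ℕ) : ℝ) + -(((N : ℝ) + 1) * a) := by
      push_cast
      ring
    rw [h1, Int.ceil_natCast_add, Int.ceil_neg, ← Int.natCast_floor_eq_floor (by positivity),
      show ⌊((N : ℝ) + 1) * a⌋₊ = k from hk]
    push_cast [Nat.cast_sub hkN]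
    ring
  rw [conformalThreshold, h, Int.cast_natCast]

theorem measurable_empiricalQuantile {Ω : Type*} [MeasurableSpace Ω] {N m : ℕ} (hm : 0 < m)
    (hmN : m ≤ N) {v : Ω → Fin N → ℝ} (hv : ∀ i, Measurable fun ω => v ω i) :
    Measurable fun ω => empiricalQuantile ((m : ℝ) / N) (v ω) := by
  classical
  refine measurable_of_Iic fun c => ?_
  have h : (fun ω => empiricalQuantile ((m : ℝ) / N) (v ω)) ⁻¹' Set.Iic c =
      {ω | m ≤ ∑ i, if v ω i ≤ c then 1 else 0} := by
    ext ω
    rw [Set.mem_preimage, Set.mem_Iic, empiricalQuantile_le_iff hm hmN, Nat.card_eq_fintype_card,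
      Fintype.card_subtype, Finset.card_filter, Set.mem_ofPred_eq]
  rw [h]
  refine measurableSet_le measurable_const (Finset.measurable_sum _ fun i _ => ?_)
  exact Measurable.ite (measurableSet_le (hv i) measurable_const) measurable_const
    measurable_const

theorem measurable_miscoverage {Θ 𝒳 𝒴 : Type*} [MeasurableSpace Θ] [MeasurableSpace 𝒳]
    [MeasurableSpace 𝒴] (𝒟 : Measure (𝒳 × 𝒴)) [IsProbabilityMeasure 𝒟] {s : Θ → 𝒳 → 𝒴 → ℝ}
    (hs : Measurable fun p : Θ × 𝒳 × 𝒴 => s p.1 p.2.1 p.2.2) {N : ℕ} {a : ℝ}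
    (ha : 0 ≤ a) (hk0 : 0 < calibrationIndex N a) (hkN : calibrationIndex N a ≤ N) :
    Measurable fun q : Θ × (Fin N → 𝒳 × 𝒴) => miscoverage 𝒟 s q.2 a q.1 := by
  have hτ : Measurable fun q : Θ × (Fin N → 𝒳 × 𝒴) => conformalThreshold s q.2 a q.1 := by
    simp_rw [fun q : Θ × (Fin N → 𝒳 × 𝒴) => conformalThreshold_eq s q.2 ha rfl
      (hkN.trans N.le_succ) q.1]
    refine measurable_empiricalQuantile (by omega) (by omega) fun i => ?_
    exact hs.comp (measurable_fst.prodMk ((measurable_pi_apply i).comp measurable_snd))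
  have hset : MeasurableSet {r : (Θ × (Fin N → 𝒳 × 𝒴)) × (𝒳 × 𝒴) |
      r.2.2 ∉ predictionSet s r.1.1 (conformalThreshold s r.1.2 a r.1.1) r.2.1} := by
    simp only [predictionSet, Set.mem_ofPred_eq, not_le]
    exact measurableSet_lt (hτ.comp measurable_fst)
      (hs.comp ((measurable_fst.comp measurable_fst).prodMk measurable_snd))
  exact measurable_measure_prodMk_left hset

theorem lintegral_exp_miscoverage_le {Θ 𝒳 𝒴 : Type*} [MeasurableSpace Θ] [MeasurableSpace 𝒳]
    [MeasurableSpace 𝒴] (𝒟 : Measure (𝒳 × 𝒴)) [IsProbabilityMeasure 𝒟] {s : Θ → 𝒳 → 𝒴 → ℝ}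
    (hs : Measurable fun p : Θ × 𝒳 × 𝒴 => s p.1 p.2.1 p.2.2) {κ l : ℕ} {a α c : ℝ}
    (ha : 0 ≤ a) (hk : calibrationIndex (κ + l + 1) a = κ + 1) (h0 : 0 < α) (h1 : α < 1)
    (hc : c = l / (1 - α) - κ / α) (hc0 : 0 ≤ c) (θ : Θ) :
    ∫⁻ D, ENNReal.ofReal (Real.exp (c * ((miscoverage 𝒟 s D a θ).toReal - α)))
        ∂(Measure.pi fun _ : Fin (κ + l + 1) => 𝒟) ≤
      ENNReal.ofReal ((((κ + l : ℕ) : ℝ) + 1) * (bernsteinPolynomial ℝ (κ + l) κ).eval α) := by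
  have hm : Measurable fun D : Fin (κ + l + 1) → 𝒳 × 𝒴 => miscoverage 𝒟 s D a θ :=
    (measurable_miscoverage 𝒟 hs ha (by omega) (by omega)).comp measurable_prodMk_left
  have hle : ∀ D : Fin (κ + l + 1) → 𝒳 × 𝒴, miscoverage 𝒟 s D a θ ≤ 1 := fun D => prob_le_one
  refine lintegral_exp_le_of_measure_lt_le _ hm.ennreal_toReal (fun _ => ENNReal.toReal_nonneg)
    (fun D => ENNReal.toReal_le_of_le_ofReal zero_le_one (by simpa using hle D))
    (fun t ht0 ht1 => ?_) h0 h1 hc hc0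
  refine le_trans (measure_mono fun D hD => ?_) (measure_lt_survival_empiricalQuantile_le 𝒟
    (σ := fun z => s θ z.1 z.2) (hs.comp measurable_prodMk_left) (Nat.le_add_right κ l) ht0 ht1)
  simp only [Set.mem_ofPred_eq] at hD ⊢
  rw [← ENNReal.ofReal_lt_iff_lt_toReal ht0 ((hle D).trans_lt ENNReal.one_lt_top).ne,
    miscoverage, conformalThreshold_eq s D ha hk (by omega) θ] at hD
  simp only [predictionSet, Set.mem_ofPred_eq, not_le] at hD
  rwa [show κ + l + 1 + 1 - (κ + 1) = κ + l + 1 - κ by omega] at hD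

/-! ### Change of measure and conclusion -/

/-- Change of measure: a bound on an exponential moment of `p` under `P` bounds the mean of `p`
under every `Q` whose divergence from `P` is at most the logarithmic slack. -/
theorem lintegral_le_of_klDiv_le {Θ : Type*} [MeasurableSpace Θ] {Q P : Measure Θ}
    [IsProbabilityMeasure Q] [IsProbabilityMeasure P] {p : Θ → ENNReal} (hpm : Measurable p)
    (hle : ∀ θ, p θ ≤ 1) {c α b δ : ℝ} (hc0 : 0 < c) (hb0 : 0 < b) (hδ : 0 < δ)
    (hX : ∫⁻ θ, ENNReal.ofReal (Real.exp (c * ((p θ).toReal - α))) ∂P ≤ ENNReal.ofReal (b / δ))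
    (hKL : (InformationTheory.klDiv Q P : EReal) ≤ (Real.log (δ / b) : EReal)) :
    ∫⁻ θ, p θ ∂Q ≤ ENNReal.ofReal α := by
  have hp1 : ∀ θ, (p θ).toReal ≤ 1 := fun θ =>
    ENNReal.toReal_le_of_le_ofReal zero_le_one (by simpa using hle θ)
  have hpint : Integrable (fun θ => (p θ).toReal) Q :=
    Integrable.of_bound hpm.ennreal_toReal.aestronglyMeasurable 1
      (ae_of_all _ fun θ => by simpa [abs_of_nonneg] using hp1 θ)
  have hexpm : Measurable fun θ => Real.exp (c * ((p θ).toReal - α)) :=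
    Real.measurable_exp.comp ((hpm.ennreal_toReal.sub_const α).const_mul c)
  have hexpint : Integrable
      (fun θ => Real.exp (c * ((p θ).toReal - α))) P :=
    Integrable.of_bound hexpm.aestronglyMeasurable (Real.exp (c * (1 - α)))
      (ae_of_all _ fun θ => by
        rw [Real.norm_eq_abs, Real.abs_exp, Real.exp_le_exp]
        exact mul_le_mul_of_nonneg_left (by linarith [hp1 θ]) hc0.le)
  have hKLtop : InformationTheory.klDiv Q P ≠ ⊤ := by
    intro h
    rw [h, EReal.coe_ennreal_top] at hKL
    exact absurd hKL (not_le.2 (EReal.coe_lt_top _))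
  have hKLreal : (InformationTheory.klDiv Q P).toReal ≤ Real.log (δ / b) := by
    have h := EReal.toReal_le_toReal hKL (by simp [EReal.coe_ennreal_ne_bot]) (by simp)
    simpa using h
  have hXle : ∫ θ, Real.exp (c * ((p θ).toReal - α)) ∂P ≤ b / δ := by
    rw [← ENNReal.ofReal_le_ofReal_iff (by positivity), ofReal_integral_eq_lintegral_ofReal hexpint
      (ae_of_all _ fun θ => (Real.exp_pos _).le)]
    exact hX
  have hDV := integral_le_toReal_klDiv_add_log hKLtop ((hpint.sub (integrable_const α)).const_mul c)
    hexpint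
  have hlog : Real.log (∫ θ, Real.exp (c * ((p θ).toReal - α)) ∂P) ≤
      Real.log (b / δ) := Real.log_le_log (integral_exp_pos hexpint) hXle
  have hcancel : Real.log (δ / b) + Real.log (b / δ) = 0 := by
    rw [← Real.log_mul (by positivity) (by positivity), div_mul_div_cancel₀ hb0.ne',
      div_self hδ.ne', Real.log_one]
  simp only [Pi.sub_apply] at hDV
  rw [integral_const_mul, integral_sub hpint (integrable_const α), integral_const] at hDV
  simp only [probReal_univ, one_smul] at hDV
  have hfinal : ∫ θ, (p θ).toReal ∂Q ≤ α := by
    have : c * (∫ θ, (p θ).toReal ∂Q - α) ≤ 0 := by linarith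
    linarith [nonpos_of_mul_nonpos_right this hc0]
  calc ∫⁻ θ, p θ ∂Q
      = ∫⁻ θ, ENNReal.ofReal (p θ).toReal ∂Q :=
        lintegral_congr fun θ =>
          (ENNReal.ofReal_toReal ((hle θ).trans_lt ENNReal.one_lt_top).ne).symm
    _ = ENNReal.ofReal (∫ θ, (p θ).toReal ∂Q) :=
        (ofReal_integral_eq_lintegral_ofReal hpint
          (ae_of_all _ fun θ => ENNReal.toReal_nonneg)).symm
    _ ≤ ENNReal.ofReal α := ENNReal.ofReal_le_ofReal hfinal

theorem corollary1 {Θ 𝒳 𝒴 : Type*} [MeasurableSpace Θ] [MeasurableSpace 𝒳] [MeasurableSpace 𝒴]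
    (𝒟 : Measure (𝒳 × 𝒴)) [IsProbabilityMeasure 𝒟]
    (s : Θ → 𝒳 → 𝒴 → ℝ) (hs : Measurable fun p : Θ × 𝒳 × 𝒴 => s p.1 p.2.1 p.2.2)
    (P : Measure Θ) [IsProbabilityMeasure P]
    (N : ℕ) (hN : 2 ≤ N) (a α δ : ℝ) (ha : 0 < a) (haα : a ≤ α) (hα : α < 1)
    (hNa : 1 ≤ ((N : ℝ) + 1) * a) (hδ : 0 < δ) (hδ1 : δ < 1) :
    ∃ E : Set (Fin N → 𝒳 × 𝒴), MeasurableSet E ∧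
      ENNReal.ofReal (1 - δ) < Measure.pi (fun _ : Fin N => 𝒟) E ∧
      ∀ D ∈ E, ∀ Q : Measure Θ, IsProbabilityMeasure Q →
        (InformationTheory.klDiv Q P : EReal) ≤ (klBudget α a δ N : EReal) →
        randomizedMiscoverage 𝒟 s D a Q ≤ ENNReal.ofReal α := by
  have hα0 : 0 < α := ha.trans_le haα
  have hα1 : 0 < 1 - α := sub_pos.2 hα
  have hkle : (calibrationIndex N a : ℝ) ≤ (N + 1) * a := Nat.floor_le (by positivity)
  have hk1 : 1 ≤ calibrationIndex N a := Nat.le_floor (by simpa using hNa)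
  have hkN : calibrationIndex N a < N + 1 := by
    have : (N + 1 : ℝ) * a < N + 1 := mul_lt_of_lt_one_right (by positivity) (haα.trans_lt hα)
    exact_mod_cast hkle.trans_lt this
  obtain ⟨κ, hκ⟩ : ∃ κ, calibrationIndex N a = κ + 1 := ⟨_, (Nat.sub_add_cancel hk1).symm⟩
  obtain ⟨l, rfl⟩ : ∃ l, N = κ + l + 1 := ⟨N - κ - 1, by omega⟩
  have hbudget := klBudget_eq_log hα0 hα hδ (by omega) hκ
  have hκα : (κ : ℝ) + 1 ≤ (κ + l + 2) * α := by
    rw [hκ] at hkle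
    push_cast at hkle
    have : (κ + l + 1 + 1 : ℝ) * a ≤ (κ + l + 1 + 1) * α := by gcongr
    linarith
  set b : ℝ := (((κ + l : ℕ) : ℝ) + 1) * (bernsteinPolynomial ℝ (κ + l) κ).eval α with hb
  have hb0 : 0 < b := by
    have : 0 < (κ + l).choose κ := Nat.choose_pos (Nat.le_add_right κ l)
    rw [hb, eval_bernsteinPolynomial]
    positivity
  rcases le_or_gt ((κ + l : ℝ) * α) κ with hcase | hcase
  -- The Beta density at `α` is at least `1` here, so the budget is negative.
  · refine ⟨Set.univ, MeasurableSet.univ, ?_, fun D _ Q _ hQ => absurd hQ (not_le.2 ?_)⟩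
    · rw [measure_univ, ← ENNReal.ofReal_one]
      exact (ENNReal.ofReal_lt_ofReal_iff one_pos).2 (by linarith)
    -- With `n = κ + l`, `n α ≤ κ` gives `(n + 1) α ≤ κ + 1`, and `κ + 1 ≤ (n + 2) α` gives `κ ≤ (n
    -- + 1) α`: so `κ` is a mode.
    · have hb1 : 1 ≤ b := by
        refine one_le_mul_eval_bernsteinPolynomial hα0 hα (Nat.le_add_right κ l) ?_ ?_
        all_goals push_cast; linarith
      have : klBudget α a δ (κ + l + 1) < 0 := by
        rw [hbudget]
        exact Real.log_neg (by positivity) ((div_lt_one hb0).2 (hδ1.trans_le hb1))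
      exact (EReal.coe_lt_coe_iff.2 this).trans_le (EReal.coe_ennreal_nonneg _)
  set c : ℝ := l / (1 - α) - κ / α with hc
  have hc0 : 0 < c := by
    rw [hc, sub_pos, div_lt_div_iff₀ hα0 hα1]
    linarith
  have hmis := measurable_miscoverage 𝒟 hs ha.le (by omega : 0 < calibrationIndex (κ + l + 1) a)
    (by omega)
  have hF : Measurable fun q : Θ × (Fin (κ + l + 1) → 𝒳 × 𝒴) =>
      Real.exp (c * ((miscoverage 𝒟 s q.2 a q.1).toReal - α)) :=
    Real.measurable_exp.comp ((hmis.ennreal_toReal.sub_const α).const_mul c)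
  have hX : Measurable fun D : Fin (κ + l + 1) → 𝒳 × 𝒴 =>
      ∫⁻ θ, ENNReal.ofReal (Real.exp (c * ((miscoverage 𝒟 s D a θ).toReal - α))) ∂P :=
    hF.ennreal_ofReal.lintegral_prod_left'
  have hEX : ∫⁻ D, ∫⁻ θ, ENNReal.ofReal (Real.exp (c * ((miscoverage 𝒟 s D a θ).toReal - α))) ∂P
      ∂(Measure.pi fun _ : Fin (κ + l + 1) => 𝒟) ≤ ENNReal.ofReal b := by
    rw [lintegral_lintegral_swap (f := fun D θ =>
      ENNReal.ofReal (Real.exp (c * ((miscoverage 𝒟 s D a θ).toReal - α))))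
        (hF.ennreal_ofReal.comp measurable_swap).aemeasurable]
    refine (lintegral_mono fun θ =>
      lintegral_exp_miscoverage_le 𝒟 hs ha.le hκ hα0 hα hc hc0.le θ).trans ?_
    simp [hb]
  have hmarkov := measure_lt_mul_lt hX hb0 hδ hEX
  -- The event involves only `P`, never `Q`; hence the bound is uniform over data-dependent `Q`.
  refine ⟨{D | ∫⁻ θ, ENNReal.ofReal (Real.exp (c * ((miscoverage 𝒟 s D a θ).toReal - α))) ∂P ≤
    ENNReal.ofReal (b / δ)}, measurableSet_le hX measurable_const, ?_, fun D hD Q hQ hKL => ?_⟩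
  · have hcompl := prob_compl_eq_one_sub (μ := Measure.pi fun _ : Fin (κ + l + 1) => 𝒟)
      (measurableSet_lt measurable_const hX : MeasurableSet {D | ENNReal.ofReal (b / δ) <
        ∫⁻ θ, ENNReal.ofReal (Real.exp (c * ((miscoverage 𝒟 s D a θ).toReal - α))) ∂P})
    rw [Set.compl_ofPred] at hcompl
    simp only [not_lt] at hcompl
    rw [hcompl, ENNReal.ofReal_sub _ hδ.le, ENNReal.ofReal_one]
    exact (ENNReal.cancel_of_ne (ENNReal.sub_ne_top ENNReal.one_ne_top)).tsub_lt_tsub_left_of_le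
      (ENNReal.ofReal_le_one.2 hδ1.le) hmarkov
  refine lintegral_le_of_klDiv_le (hmis.comp measurable_prodMk_right) (fun θ => prob_le_one)
    hc0 hb0 hδ ?_ (hbudget ▸ hKL)
  exact hD
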